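/- **Setting.** Let $h\ge 1$ and let $\mathbf d=(d_0,\dots,d_h)$ be positive integers. For activation degrees $\mathbf r=(r_{h-1},\dots,r_1)\in\mathbb N^{h-1}$ let $\rho_{r}$ denote the map raising every entry of a column to the $r$-th power, and consider the map $$\Phi_{\mathbf d,\mathbf r}:(W_h,\dots,W_1)\longmapsto W_h\,\rho_{r_{h-1}}W_{h-1}\,\rho_{r_{h-2}}\cdots\rho_{r_1}W_1x,\qquad W_i\in\mathbb R^{d_i\times d_{i-1}},\ x=(x_1,\dots,x_{d_0})^T,$$ with values in the space $\mathrm{Sym}_{D}(\mathbb R^{d_0})^{d_h}$ of columns of $d_h$ real homogeneous polynomials of degree $D=\prod_i r_i$ in $x_1,\dots,x_{d_0}$. For a single degree $r$ (all $r_i=r$, so $D=r^{h-1}$), let $\mathcal V_{\mathbf d,r}$ be the Zariski closure of the image of this map. The dimension of a subset $S$ of such a space is the Krull dimension of its ring of polynomial functions (real polynomials in the coefficients modulo those vanishing on $S$); $S$ and its Zariski closure have the same dimension. **Conjecture (independence of powers).** For all integers $m,k\ge 0$ there is $\tilde r=\tilde r(m,k)$ such that, for every $s\geq 0$ and all nonzero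 homogeneous $p_1,\dots,p_k\in\mathbb R[x_1,\dots,x_m]$ of the same degree $s$, no two of which are linearly dependent, the powers $p_1^r,\dots,p_k^r$ are linearly independent for all $r>\tilde r$. **Theorem (Naive bound and equality for high activation degree).** 1. For every $r\in\mathbb N$, $$\dim \mathcal V_{\mathbf d,r}\ \le\ \min\left(d_h+\sum_{i=1}^h (d_{i-1}-1)d_i,\ \ d_h\binom{d_0+r^{h-1}-1}{r^{h-1}}\right).$$ 2. Assume the Conjecture. If $d_i>1$ for $i=1,\dots,h-1$, then there exists $\tilde r=\tilde r(\mathbf d)$ such that equality holds in 1 for all $r>\tilde r$. 3. Unconditionally, if $h\ge 2$ and $d_i>1$ for $i=0,1,\dots,h-1$, then there are infinitely many tuples $(r_{h-1},\dots,r_1)$ for which the image of $\Phi_{\mathbf d,\mathbf r}$ has dimension exactly $d_h+\sum_{i=1}^h(d_{i-1}-1)d_i$. -/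

import Mathlib

namespace PolyNet

open MvPolynomial

/-- The space `Sym_D(ℝ^m)` of real homogeneous polynomials of degree `D` in `m` variables. -/
abbrev HomPoly (D m : ℕ) : Type :=
  homogeneousSubmodule (Fin m) ℝ D

/-! ### Polynomial networks

A network of depth `h = n + 1` has widths `d 0, …, d (n + 1)`, weight matrices
`W 0, …, W n`, where `W i` has size `d (i + 1) × d i`, and `n` activations between consecutive
weight matrices, the `i`-th one raising every entry to the power `r i`. -/

/-- The weights of a network with architecture `d`. -/
abbrev Weights {n : ℕ} (d : Fin (n + 2) → ℕ) : Type :=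
  (i : Fin (n + 1)) → Matrix (Fin (d i.succ)) (Fin (d i.castSucc)) ℝ

/-- The product of a real matrix and a column of polynomials. -/
noncomputable def mulPoly {a b m : ℕ} (A : Matrix (Fin a) (Fin b) ℝ)
    (v : Fin b → MvPolynomial (Fin m) ℝ) : Fin a → MvPolynomial (Fin m) ℝ :=
  fun k => ∑ j, A k j • v j

/-- The column of polynomials obtained right after multiplication by the weight matrix `W i`:
`W 0 x` for `i = 0`, and `W (i + 1) ρ (previous column)` with `ρ` the `r i`-th power. -/
noncomputable def layer {n : ℕ} {d : Fin (n + 2) → ℕ} (r : Fin n → ℕ) (W : Weights d)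
    (i : Fin (n + 1)) : Fin (d i.succ) → MvPolynomial (Fin (d 0)) ℝ :=
  Fin.induction (motive := fun i => Fin (d i.succ) → MvPolynomial (Fin (d 0)) ℝ)
    (mulPoly (W 0) X)
    (fun i v => mulPoly (W i.succ) (fun j => v j ^ r i)) i

theorem mulPoly_isHomogeneous {a b m D : ℕ} (A : Matrix (Fin a) (Fin b) ℝ)
    {v : Fin b → MvPolynomial (Fin m) ℝ} (hv : ∀ j, (v j).IsHomogeneous D) (k : Fin a) :
    (mulPoly A v k).IsHomogeneous D := by
  rw [← mem_homogeneousSubmodule]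
  exact Submodule.sum_mem _ fun j _ => Submodule.smul_mem _ _ (hv j)

theorem layer_isHomogeneous {n : ℕ} {d : Fin (n + 2) → ℕ} (r : Fin n → ℕ) (W : Weights d)
    (i : Fin (n + 1)) (k : Fin (d i.succ)) :
    (layer r W i k).IsHomogeneous (∏ j with Fin.castSucc j < i, r j) := by
  induction i using Fin.induction with
  | zero =>
    have h : (∏ j with Fin.castSucc j < (0 : Fin (n + 1)), r j) = 1 := by simp
    rw [h]
    exact mulPoly_isHomogeneous (W 0) (fun j => isHomogeneous_X ℝ j) k
  | succ i ih =>
    have h : (∏ j with Fin.castSucc j < i.succ, r j)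
        = (∏ j with Fin.castSucc j < i.castSucc, r j) * r i := by
      have h' : (Finset.univ.filter fun j : Fin n => Fin.castSucc j < i.succ)
          = insert i (Finset.univ.filter fun j : Fin n => Fin.castSucc j < i.castSucc) := by
        ext j
        simp only [Finset.mem_filter, Finset.mem_univ, true_and, Finset.mem_insert,
          Fin.lt_def, Fin.ext_iff, Fin.val_castSucc, Fin.val_succ]
        omega
      rw [h', Finset.prod_insert (by simp), mul_comm]
    rw [h]
    exact mulPoly_isHomogeneous (W i.succ) (fun j => (ih j).pow (r i)) k

/-- The network map `(W_h, …, W_1) ↦ W_h ρ_{r_{h-1}} W_{h-1} ⋯ ρ_{r_1} W_1 x`, with values in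
columns of `d_h` homogeneous polynomials of degree `∏ r_i` in `d_0` variables. -/
noncomputable def networkMap {n : ℕ} (d : Fin (n + 2) → ℕ) (r : Fin n → ℕ) (W : Weights d) :
    Fin (d (Fin.last (n + 1))) → HomPoly (∏ i, r i) (d 0) :=
  fun k => ⟨layer r W (Fin.last n) k, by
    have h := layer_isHomogeneous r W (Fin.last n) k
    simpa [Fin.castSucc_lt_last] using h⟩

/-- The functional space: the image of the network map. -/
def functionalSpace {n : ℕ} (d : Fin (n + 2) → ℕ) (r : Fin n → ℕ) :
    Set (Fin (d (Fin.last (n + 1))) → HomPoly (∏ i, r i) (d 0)) :=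
  Set.range (networkMap d r)

/-! ### Zariski closure and dimension in the space of columns of homogeneous polynomials -/

/-- The index set of the coefficients of a column of `k` homogeneous polynomials of degree `D`
in `m` variables: the row, and an exponent vector of total degree `D`. -/
abbrev CoeffIndex (k D m : ℕ) : Type :=
  Fin k × {e : Fin m →₀ ℕ // e.degree = D}

/-- The linear coordinates on the space of columns of homogeneous polynomials given by the
coefficients. -/
def coords {k D m : ℕ} (p : Fin k → HomPoly D m) : CoeffIndex k D m → ℝ :=
  fun e => coeff e.2.1 (p e.1 : MvPolynomial (Fin m) ℝ)

/-- The ideal of all real polynomials in the coefficients that vanish on `S`. -/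
noncomputable def idealOf {k D m : ℕ} (S : Set (Fin k → HomPoly D m)) :
    Ideal (MvPolynomial (CoeffIndex k D m) ℝ) :=
  vanishingIdeal ℝ (coords '' S)

/-- The Zariski closure of `S`: the common zeros of all polynomials in the coefficients that
vanish on `S`. -/
def zariskiClosure {k D m : ℕ} (S : Set (Fin k → HomPoly D m)) :
    Set (Fin k → HomPoly D m) :=
  {p | ∀ F ∈ idealOf S, eval (coords p) F = 0}

/-- The dimension of `S` as a real algebraic (or semialgebraic) set: the Krull dimension of its
ring of polynomial functions. -/
noncomputable def dimension {k D m : ℕ} (S : Set (Fin k → HomPoly D m)) : WithBot ℕ∞ :=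
  ringKrullDim (MvPolynomial (CoeffIndex k D m) ℝ ⧸ idealOf S)

/-- The functional variety `V_{d,r}` for a single activation degree `r`. -/
def functionalVariety {n : ℕ} (d : Fin (n + 2) → ℕ) (r : ℕ) :
    Set (Fin (d (Fin.last (n + 1))) → HomPoly (∏ _i : Fin n, r) (d 0)) :=
  zariskiClosure (functionalSpace d fun _ => r)

/-- The number `d_h + ∑_{i=1}^h (d_{i-1} - 1) d_i` (for positive widths). -/
def expectedDim {n : ℕ} (d : Fin (n + 2) → ℕ) : ℕ :=
  d (Fin.last (n + 1)) + ∑ i : Fin (n + 1), (d i.castSucc - 1) * d i.succ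

/-- The dimension `d_h * C(d_0 + r^{h-1} - 1, r^{h-1})` of the ambient space. -/
def ambientDim {n : ℕ} (d : Fin (n + 2) → ℕ) (r : ℕ) : ℕ :=
  d (Fin.last (n + 1)) * (d 0 + r ^ n - 1).choose (r ^ n)

/-- The conjecture on linear independence of powers: for all `m` and `k` there is a threshold
`r₀`, depending on `m` and `k` only, such that for all `k` homogeneous polynomials of the same
degree `s` in `m` variables, no two of which are linearly dependent, the `r`-th powers are
linearly independent whenever `r > r₀`. For `k ≥ 2` the polynomials are automatically nonzero;
the condition `p i ≠ 0` only excludes the single polynomial `0` when `k = 1`. -/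
def PowerIndependenceConjecture : Prop :=
  ∀ m k : ℕ, ∃ r₀ : ℕ, ∀ (s : ℕ) (p : Fin k → MvPolynomial (Fin m) ℝ),
    (∀ i, (p i).IsHomogeneous s) → (∀ i, p i ≠ 0) →
    (∀ i j, i ≠ j → LinearIndependent ℝ ![p i, p j]) →
    ∀ r > r₀, LinearIndependent ℝ (fun i => p i ^ r)

end PolyNet

namespace PolyNet

open MvPolynomial

/-! ### Krull dimension and transcendence degree -/

/-! Upper bound: rescaling hidden entries turns the first column of every weight matrix but the last
into ones, on a Zariski dense set of weights, and `expectedDim d` parameters remain. The coordinate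
ring of the image is therefore a finitely generated subalgebra of a polynomial ring in that many
variables (`idealOf_functionalSpace`). By Noether normalization its Krull dimension is its
transcendence degree, which is at most the number of variables.

Lower bound: it suffices that the differential of the normalized parametrization is injective at one
point (`le_ringKrullDim_quotient_ker`). Substitute `x_l = X ^ l` and choose weights for which the
entries `A_j` of each column are pairwise coprime in `ℝ[X]`, of one common degree. For a tangent
vector in the kernel, the derivative of the last column vanishes, which is a relation `∑ A_j ^ (r -
1) * q_j = 0` over the previous column with `deg q_j ≤ deg A_j`. For large `r` all `q_j` vanish, so
the derivative of the previous column is entrywise proportional to that column. The argument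
descends through the layers, and the normalization kills every proportionality factor and every
tangent weight (`tangent_eq_zero`).

The independence used here is a Wronskian induction (`exists_forall_sum_pow_mul_eq_zero`). Its
threshold does not depend on the degree of the `A_j`, which is essential because that degree grows
with `r`. With one input variable the image is the whole space. -/

theorem ringKrullDim_eq_of_isIntegral (R S : Type*) [CommRing R] [CommRing S] [Algebra R S]
    [Algebra.IsIntegral R S] [FaithfulSMul R S] : ringKrullDim S = ringKrullDim R := by
  apply le_antisymm
  · refine Order.krullDim_le_of_strictMono (PrimeSpectrum.comap (algebraMap R S)) ?_
    intro p q hpq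
    exact Ideal.IsIntegral.comap_lt_comap (I := p.asIdeal) (J := q.asIdeal) hpq
  · refine iSup_le fun l => ?_
    obtain ⟨Q, _, hQ₁, hQ₂⟩ := Ideal.exists_ideal_over_prime_of_isIntegral
      (RelSeries.head l).asIdeal (⊥ : Ideal S)
      (by rw [← RingHom.ker_eq_comap_bot,
        (RingHom.injective_iff_ker_eq_bot _).mp (FaithfulSMul.algebraMap_injective R S)]
          exact bot_le)
    have : Q.LiesOver (RelSeries.head l).asIdeal := ⟨hQ₂.symm⟩
    obtain ⟨L, hL, -, -⟩ := Ideal.exists_ltSeries_of_hasGoingUp l Q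
    rw [← hL]
    exact Order.LTSeries.length_le_krullDim L

/-- Noether normalization: the algebra is integral over a polynomial ring in `s` variables, and both
invariants are unchanged by integral extension. -/
theorem exists_ringKrullDim_eq_and_trdeg_eq (k B : Type) [Field k] [CommRing B] [IsDomain B]
    [Algebra k B] [Algebra.FiniteType k B] :
    ∃ s : ℕ, ringKrullDim B = s ∧ Algebra.trdeg k B = s := by
  obtain ⟨s, g, hg, hint⟩ := exists_integral_inj_algHom_of_fg k B
  algebraize [g.toRingHom]
  have : IsScalarTower k (MvPolynomial (Fin s) k) B :=
    IsScalarTower.of_algebraMap_eq fun x => (g.commutes x).symm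
  have : FaithfulSMul (MvPolynomial (Fin s) k) B :=
    (faithfulSMul_iff_algebraMap_injective _ _).mpr hg
  have : Algebra.IsIntegral (MvPolynomial (Fin s) k) B := ⟨hint⟩
  refine ⟨s, ?_, ?_⟩
  · rw [ringKrullDim_eq_of_isIntegral (MvPolynomial (Fin s) k) B,
      MvPolynomial.ringKrullDim_of_isNoetherianRing]
    simp
  · rw [← trdeg_add_eq k (MvPolynomial (Fin s) k) (A := B),
      trdeg_eq_zero (R := MvPolynomial (Fin s) k) (A := B)]
    simp

/-! ### The Jacobian criterion for algebraic independence -/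

theorem coeff_pderiv' {k τ : Type*} [CommSemiring k] (i : τ) (p : MvPolynomial τ k) (m : τ →₀ ℕ) :
    coeff m (pderiv i p) = coeff (m + Finsupp.single i 1) p * (m i + 1) := by
  classical
  induction p using MvPolynomial.induction_on' with
  | monomial u a =>
    rw [pderiv_monomial, coeff_monomial, coeff_monomial]
    by_cases hu : u = m + Finsupp.single i 1
    · simp [hu]
    · rw [if_neg hu, zero_mul]
      split_ifs with h
      · have hi : u i = 0 := by
          by_contra hi
          apply hu
          rw [← h, tsub_add_cancel_of_le]
          simpa [Finsupp.single_le_iff] using Nat.one_le_iff_ne_zero.mpr hi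
        simp [hi]
      · rfl
  | add p q hp hq => simp [hp, hq, add_mul]

theorem totalDegree_pderiv_le {k τ : Type*} [CommSemiring k] (i : τ) (p : MvPolynomial τ k)
    (N : ℕ) (hp : p.totalDegree ≤ N + 1) : (pderiv i p).totalDegree ≤ N := by
  refine Finset.sup_le fun m hm => ?_
  rw [mem_support_iff, coeff_pderiv'] at hm
  have h := (le_totalDegree (mem_support_iff.mpr (left_ne_zero_of_mul hm))).trans hp
  change (m + Finsupp.single i 1).degree ≤ N + 1 at h
  change m.degree ≤ N
  rw [map_add, Finsupp.degree_single] at h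
  omega

theorem eq_C_of_pderiv_eq_zero {k τ : Type*} [Field k] [CharZero k] (p : MvPolynomial τ k)
    (hp : ∀ i, pderiv i p = 0) : p = C (coeff 0 p) := by
  classical
  ext m
  rw [coeff_C]
  split_ifs with h
  · rw [h]
  · obtain ⟨i, hi⟩ : ∃ i, m i ≠ 0 := by
      by_contra! h'
      exact h (Finsupp.ext fun i => (h' i).symm)
    have h₁ := congrArg (coeff (m - Finsupp.single i 1)) (hp i)
    rw [coeff_pderiv', tsub_add_cancel_of_le
      (by simpa [Finsupp.single_le_iff] using Nat.one_le_iff_ne_zero.mpr hi), coeff_zero] at h₁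
    exact (mul_eq_zero.mp h₁).resolve_right (Nat.cast_add_one_ne_zero _)

theorem derivation_aeval {k τ A : Type*} [CommRing k] [Fintype τ] [CommRing A] [Algebra k A]
    (D : Derivation k A A) (H : τ → A) (p : MvPolynomial τ k) :
    D (aeval H p) = ∑ i, aeval H (pderiv i p) * D (H i) := by
  classical
  induction p using MvPolynomial.induction_on with
  | C a => simp
  | add p q hp hq => simp [hp, hq, add_mul, Finset.sum_add_distrib]
  | mul_X p j hp =>
    simp [hp, pderiv_X, Pi.single_apply, add_mul, Finset.sum_add_distrib, apply_ite, Finset.mul_sum,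
      mul_assoc]

/-- A tuple of polynomials whose Jacobian determinant is nonzero is algebraically independent. -/
theorem algebraicIndependent_of_jacobian {k τ : Type*} [Field k] [CharZero k] [Fintype τ]
    [DecidableEq τ] (H : τ → MvPolynomial τ k)
    (hdet : (Matrix.of fun i j => pderiv j (H i)).det ≠ 0) : AlgebraicIndependent k H := by
  rw [algebraicIndependent_iff]
  have key : ∀ N : ℕ, ∀ p : MvPolynomial τ k, p.totalDegree ≤ N → aeval H p = 0 → p = 0 := by
    intro N
    induction N with
    | zero =>
      intro p hp h0
      rw [totalDegree_eq_zero_iff_eq_C.mp (Nat.le_zero.mp hp)] at h0 ⊢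
      simpa using h0
    | succ N ih =>
      intro p hp h0
      -- By the chain rule the gradient of `p` at `H` is a row vector killed by the Jacobian matrix.
      -- The partial derivatives of `p` are then relations of smaller degree.
      have hz : (fun i => aeval H (pderiv i p)) = 0 := by
        refine Matrix.eq_zero_of_vecMul_eq_zero hdet ?_
        ext1 j
        have h := derivation_aeval (pderiv j) H p
        rw [h0, map_zero] at h
        exact h.symm
      rw [eq_C_of_pderiv_eq_zero p
        fun i => ih _ (totalDegree_pderiv_le i p N hp) (congrFun hz i)] at h0 ⊢
      simpa using h0
  exact fun p hp => key _ p le_rfl hp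

/-! ### Krull dimension of the image of a polynomial map -/

section Rank

variable {k σ τ : Type} [Field k] [Finite σ]
  (φ : MvPolynomial σ k →ₐ[k] MvPolynomial τ k)

theorem exists_ringKrullDim_quotient_ker : ∃ s : ℕ,
    ringKrullDim (MvPolynomial σ k ⧸ RingHom.ker φ) = s ∧ Algebra.trdeg k φ.range = s := by
  have : Algebra.FiniteType k φ.range :=
    Algebra.FiniteType.of_surjective φ.rangeRestrict φ.rangeRestrict_surjective
  obtain ⟨s, h₁, h₂⟩ := exists_ringKrullDim_eq_and_trdeg_eq k φ.range
  refine ⟨s, ?_, h₂⟩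
  rw [← h₁]
  exact ringKrullDim_eq_of_ringEquiv (Ideal.quotientKerAlgEquivOfSurjective
    φ.rangeRestrict_surjective |>.toRingEquiv |> fun e =>
      (Ideal.quotEquivOfEq (by ext; simp [RingHom.mem_ker, Subtype.ext_iff])).trans e)

theorem ringKrullDim_quotient_ker_le [Fintype τ] :
    ringKrullDim (MvPolynomial σ k ⧸ RingHom.ker φ) ≤ Fintype.card τ := by
  obtain ⟨s, h₁, h₂⟩ := exists_ringKrullDim_quotient_ker φ
  rw [h₁]
  have := trdeg_le_of_injective φ.range.val Subtype.val_injective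
  rw [h₂, MvPolynomial.trdeg_of_isDomain] at this
  simp at this
  exact_mod_cast this

/-- An injective differential at `θ` has a left inverse. Its entries give linear combinations of the
coordinates whose Jacobian matrix at `θ` is the identity, so these combinations are algebraically
independent in the image of `φ`. -/
theorem le_ringKrullDim_quotient_ker [Fintype τ] [CharZero k] (θ : τ → k)
    (hJ : ∀ v : τ → k, (∀ s, ∑ t, v t * eval θ (pderiv t (φ (X s))) = 0) → v = 0) :
    (Fintype.card τ : WithBot ℕ∞) ≤ ringKrullDim (MvPolynomial σ k ⧸ RingHom.ker φ) := by
  classical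
  obtain ⟨s, h₁, h₂⟩ := exists_ringKrullDim_quotient_ker φ
  have := Fintype.ofFinite σ
  let J : (τ → k) →ₗ[k] (σ → k) :=
    Matrix.mulVecLin (Matrix.of fun s t => eval θ (pderiv t (φ (X s))))
  have hker : LinearMap.ker J = ⊥ := by
    rw [LinearMap.ker_eq_bot']
    intro v hv
    refine hJ v fun s => ?_
    simpa [J, Matrix.mulVec, dotProduct, mul_comm] using congrFun hv s
  obtain ⟨g, hg⟩ := J.exists_leftInverse_of_injective hker
  let G : τ → MvPolynomial σ k := fun i => ∑ s, C (g (Pi.single s 1) i) * X s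
  have hdet : (Matrix.of fun i j => pderiv j (φ (G i))).det ≠ 0 := by
    intro h
    have h' := congrArg (eval θ) h
    rw [RingHom.map_det, map_zero] at h'
    have : (eval θ).mapMatrix (Matrix.of fun i j => pderiv j (φ (G i))) = 1 := by
      ext1 i j
      have h₁ := congrFun (LinearMap.congr_fun hg (Pi.single j 1)) i
      have h₂ : J (Pi.single j 1) = ∑ s, eval θ (pderiv j (φ (X s))) • Pi.single s (1 : k) := by
        ext1 s
        simp [J, Matrix.mulVec, dotProduct, Pi.single_apply]
      rw [LinearMap.comp_apply, h₂, map_sum] at h₁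
      simp only [map_smul, Finset.sum_apply, Pi.smul_apply, smul_eq_mul, LinearMap.id_apply] at h₁
      simp only [G, RingHom.mapMatrix_apply, Matrix.map_apply, Matrix.of_apply, map_sum, map_mul,
        pderiv_C_mul, algHom_C, algebraMap_eq, eval_C]
      rw [Matrix.one_apply]
      simpa [mul_comm, Pi.single_apply] using h₁
    rw [this] at h'
    simp at h'
  have hind := algebraicIndependent_of_jacobian _ hdet
  have hind' : AlgebraicIndependent k fun i => φ.rangeRestrict (G i) :=
    hind.of_comp φ.range.val
  have := hind'.cardinalMk_le_trdeg
  rw [h₂] at this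
  rw [h₁]
  simp at this
  exact_mod_cast this

end Rank

end PolyNet

namespace PolyNet

open Polynomial

/-! ### Linear independence of multiples of high powers of coprime polynomials -/

/-- Differentiating `P ^ (N + 1) * p` leaves a factor `P ^ N`. The point is that the degree bound on
the remaining factor `u` does not involve `N`. -/
theorem exists_wronskian_mul_pow {K : Type*} [Field K] {s A N : ℕ} {P Q p q : K[X]}
    (hP : P.natDegree ≤ s) (hQ : Q.natDegree ≤ s) (hp : p.natDegree ≤ A * s)
    (hq : q.natDegree ≤ A * s) :
    ∃ u : K[X], u.natDegree ≤ (2 * A + 2) * s ∧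
      wronskian (P ^ (N + 1) * p) (Q ^ (N + 1) * q) = P ^ N * u * Q ^ N := by
  refine ⟨P * p * ((N + 1 : K[X]) * derivative Q * q + Q * derivative q)
    - ((N + 1 : K[X]) * derivative P * p + P * derivative p) * (Q * q), ?_, ?_⟩
  · have h : ∀ P p : K[X], P.natDegree ≤ s → p.natDegree ≤ A * s →
        ((N + 1 : K[X]) * derivative P * p + P * derivative p).natDegree ≤ s + A * s := by
      intro P p hP hp
      refine natDegree_add_le_of_degree_le ?_ ?_
      · refine natDegree_mul_le_of_le (natDegree_mul_le_of_le (m := 0) ?_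
          ((natDegree_derivative_le P).trans ((Nat.sub_le _ _).trans hP))) hp |>.trans (by omega)
        exact_mod_cast (natDegree_natCast (R := K) (N + 1)).le
      · exact natDegree_mul_le_of_le hP ((natDegree_derivative_le p).trans
          ((Nat.sub_le _ _).trans hp))
    refine (natDegree_sub_le_of_le
      (natDegree_mul_le_of_le (natDegree_mul_le_of_le hP hp) (h Q q hQ hq))
      (natDegree_mul_le_of_le (h P p hP hp) (natDegree_mul_le_of_le hQ hq))).trans ?_
    rw [max_self]
    exact le_of_eq (by ring)
  · simp only [wronskian, derivative_mul, derivative_pow, map_add, map_natCast, Nat.cast_add,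
      Nat.cast_one, map_one, add_tsub_cancel_right]
    ring

theorem exists_isCoprime_mul_eq {R : Type*} [EuclideanDomain R] {f : R} (hf : f ≠ 0) (g : R) :
    ∃ d a b : R, d ≠ 0 ∧ IsCoprime a b ∧ d * a = f ∧ d * b = g := by
  classical
  let _ := EuclideanDomain.gcdMonoid R
  have hd : GCDMonoid.gcd g f ≠ 0 := gcd_ne_zero_of_right hf
  exact ⟨GCDMonoid.gcd g f, f / GCDMonoid.gcd g f, g / GCDMonoid.gcd g f, hd,
    (isCoprime_div_gcd_div_gcd hf).symm,
    EuclideanDomain.mul_div_cancel' hd (gcd_dvd_right g f),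
    EuclideanDomain.mul_div_cancel' hd (gcd_dvd_left g f)⟩

/-- Removing the gcd only divides the Wronskian by a square. For coprime polynomials a zero
Wronskian forces zero derivatives, that is, constants in characteristic zero. -/
theorem dvd_of_wronskian_eq_zero {K : Type*} [Field K] [CharZero K] {f g : K[X]} (hf : f ≠ 0)
    (h : wronskian f g = 0) : f ∣ g := by
  obtain ⟨d, a, b, hd, hab, ha, hb⟩ := exists_isCoprime_mul_eq hf g
  subst ha hb
  have hw : wronskian a b = 0 := by
    have : wronskian (d * a) (d * b) = d ^ 2 * wronskian a b := by
      simp only [wronskian, derivative_mul]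
      ring
    rw [this] at h
    exact (mul_eq_zero.mp h).resolve_left (pow_ne_zero 2 hd)
  have ha' := derivative_eq_zero.mp (hab.wronskian_eq_zero_iff.mp hw).1
  refine mul_dvd_mul_left d ?_
  have : IsUnit a := by
    rw [eq_C_of_natDegree_eq_zero ha'] at hf ⊢
    refine isUnit_C.mpr (isUnit_iff_ne_zero.mpr fun h0 => hf ?_)
    simp [h0]
  exact this.dvd

/-- Multiples of high powers of pairwise coprime polynomials of the same degree are linearly
independent, as long as the degrees of the cofactors are bounded. -/
theorem exists_forall_sum_pow_mul_eq_zero (K : Type*) [Field K] [CharZero K] (k A : ℕ) :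
    ∃ N₀ : ℕ, ∀ N ≥ N₀, ∀ s > 0, ∀ P q : Fin k → K[X], (∀ j, (P j).natDegree = s) →
      (Pairwise fun i j => IsCoprime (P i) (P j)) → (∀ j, (q j).natDegree ≤ A * s) →
      ∑ j, P j ^ N * q j = 0 → ∀ j, q j = 0 := by
  induction k generalizing A with
  | zero => exact ⟨0, fun _ _ _ _ _ _ _ _ _ _ j => j.elim0⟩
  | succ k ih =>
    obtain ⟨N₁, h₁⟩ := ih A
    obtain ⟨N₂, h₂⟩ := ih (2 * A + 2)
    -- `N₁` handles a vanishing last cofactor and `N₂ + 1` the relation between Wronskians, whose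
    -- exponent is `N - 1`. `A + 1` makes `N * s` exceed the degree of any cofactor.
    refine ⟨max N₁ (max (N₂ + 1) (A + 1)), fun N hN s hs P q hP hco hq hsum => ?_⟩
    simp only [ge_iff_le, max_le_iff] at hN
    have hco' : Pairwise fun i j : Fin k => IsCoprime (P i.castSucc) (P j.castSucc) :=
      fun i j hij => hco fun h => hij (Fin.castSucc_injective _ h)
    rw [Fin.sum_univ_castSucc] at hsum
    have hP0 : ∀ j, P j ≠ 0 := fun j h => by have := hP j; rw [h] at this; simp at this; omega
    suffices hlast : q (Fin.last k) = 0 by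
      rw [hlast, mul_zero, add_zero] at hsum
      have := h₁ N hN.1 s hs (fun j => P j.castSucc) (fun j => q j.castSucc) (fun j => hP _) hco'
        (fun j => hq _) hsum
      exact Fin.lastCases hlast this
    by_contra hlast
    obtain ⟨M, rfl⟩ : ∃ M, N = M + 1 := ⟨N - 1, by omega⟩
    set f : Fin (k + 1) → K[X] := fun j => P j ^ (M + 1) * q j with hf
    choose u hu hw using fun j : Fin k => exists_wronskian_mul_pow (N := M)
      (hP j.castSucc).le (hP (Fin.last k)).le (hq j.castSucc) (hq (Fin.last k))
    -- Taking the Wronskian of the relation with its last term removes that term; the common factor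
    -- `P (Fin.last k) ^ M` then cancels.
    have hzero : ∑ j, P j.castSucc ^ M * u j = 0 := by
      have : (∑ j : Fin k, P j.castSucc ^ M * u j) * P (Fin.last k) ^ M = 0 := by
        rw [Finset.sum_mul]
        simp_rw [← hw]
        simp_rw [← wronskianBilin_apply]
        rw [← LinearMap.sum_apply, ← map_sum, eq_neg_of_add_eq_zero_left hsum, map_neg,
          LinearMap.neg_apply, wronskianBilin_apply, wronskian_self_eq_zero, neg_zero]
      exact (mul_eq_zero.mp this).resolve_right (pow_ne_zero _ (hP0 _))
    have hu0 := h₂ M (by omega) s hs (fun j => P j.castSucc) u (fun j => hP _) hco' hu hzero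
    have hq0 : ∀ j : Fin k, q j.castSucc = 0 := by
      intro j
      by_contra hj
      -- The `j`-th term divides the last one, so by coprimality `P j.castSucc ^ (M + 1)` divides
      -- the last cofactor, whose degree is too small.
      have hdvd := dvd_of_wronskian_eq_zero (mul_ne_zero (pow_ne_zero _ (hP0 _)) hj)
        (by rw [hw j, hu0 j, mul_zero, zero_mul])
      have hc : IsCoprime (P j.castSucc ^ (M + 1)) (P (Fin.last k) ^ (M + 1)) :=
        (hco (Fin.castSucc_lt_last j).ne).pow
      have := natDegree_le_of_dvd (hc.dvd_of_dvd_mul_left ((dvd_mul_right _ _).trans hdvd)) hlast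
      rw [natDegree_pow, hP] at this
      have h3 := this.trans (hq _)
      have := Nat.le_of_mul_le_mul_right h3 hs
      omega
    simp only [hq0, mul_zero, Finset.sum_const_zero, zero_add] at hsum
    exact hlast ((mul_eq_zero.mp hsum).resolve_left (pow_ne_zero _ (hP0 _)))

/-! ### Generic linear combinations -/

theorem finite_setOf_sum_pow_mul_eq_zero {L : Type*} [Field L] [Algebra ℝ L] {a : ℕ}
    (c : Fin a → L) (hc : ∃ j, c j ≠ 0) :
    {w : ℝ | ∑ j : Fin a, algebraMap ℝ L w ^ (j : ℕ) * c j = 0}.Finite := by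
  classical
  let p : L[X] := ∑ j : Fin a, C (c j) * X ^ (j : ℕ)
  have hp : p ≠ 0 := by
    obtain ⟨j, hj⟩ := hc
    intro h
    apply hj
    have := congrArg (coeff · (j : ℕ)) h
    simpa [p, finsetSum_coeff, coeff_C_mul, coeff_X_pow, Fin.val_inj] using this
  refine ((p.roots.toFinset.finite_toSet).preimage
    ((algebraMap ℝ L).injective.injOn)).subset fun w hw => ?_
  rw [Set.mem_preimage, Finset.mem_coe, Multiset.mem_toFinset, mem_roots hp, IsRoot.def,
    eval_finsetSum]
  refine (Finset.sum_congr rfl fun j _ => ?_).trans hw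
  rw [eval_mul, eval_C, eval_pow, eval_X, mul_comm]

/-- Coefficient rows `(1, w, w ^ 2, …)` depend on one real number, so each unwanted event is a
nonzero polynomial equation in `w` and excludes finitely many values. The nodes `w` can then be
picked one after another. -/
theorem exists_pairwise_isCoprime_combination {a : ℕ} (u : Fin a → ℝ[X]) (s : ℕ)
    (hs : ∀ j, (u j).natDegree ≤ s) (hlead : ∃ j, (u j).coeff s ≠ 0)
    (hroot : ∀ z : ℂ, ∃ j, aeval z (u j) ≠ 0) (b : ℕ) :
    ∃ w : Fin b → ℝ, (∀ k, w k ≠ 0) ∧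
      (∀ k, (∑ j : Fin a, C (w k ^ (j : ℕ)) * u j).natDegree = s) ∧
      Pairwise fun k l =>
        IsCoprime (∑ j : Fin a, C (w k ^ (j : ℕ)) * u j) (∑ j : Fin a, C (w l ^ (j : ℕ)) * u j) := by
  let g : ℝ → ℝ[X] := fun w => ∑ j : Fin a, C (w ^ (j : ℕ)) * u j
  have hsymm : Std.Symm fun w w' => IsCoprime (g w) (g w') := ⟨fun _ _ h => h.symm⟩
  have hcoeff : ∀ w, (g w).coeff s = ∑ j : Fin a, w ^ (j : ℕ) * (u j).coeff s := fun w => by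
    simp only [g, finsetSum_coeff, coeff_C_mul]
  obtain ⟨f, hf, hf'⟩ := exists_seq_of_forall_finset_exists'
    (fun w : ℝ => w ≠ 0 ∧ (g w).coeff s ≠ 0) (fun w w' => IsCoprime (g w) (g w')) (by
      intro S hS
      -- Values to avoid: zero, those that lower the degree, and those giving a complex root in
      -- common with an earlier combination.
      have hfin : (({0} : Set ℝ) ∪ {w : ℝ | (g w).coeff s = 0} ∪
          ⋃ x ∈ S, ⋃ z ∈ ((g x).aroots ℂ).toFinset, {w : ℝ | aeval z (g w) = 0}).Finite := by
        refine ((Set.finite_singleton 0).union ?_).union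
          (S.finite_toSet.biUnion fun x _ => Set.Finite.biUnion (Finset.finite_toSet _)
            fun z _ => ?_)
        · simpa [hcoeff] using finite_setOf_sum_pow_mul_eq_zero (L := ℝ) _ hlead
        · simpa [g] using finite_setOf_sum_pow_mul_eq_zero (L := ℂ) _ (hroot z)
      obtain ⟨y, hy⟩ := hfin.infinite_compl.nonempty
      simp only [Set.mem_compl_iff, Set.mem_union, not_or, Set.mem_iUnion, not_exists] at hy
      refine ⟨y, ⟨hy.1.1, hy.1.2⟩, fun x hx => ?_⟩
      rw [isCoprime_iff_aeval_ne_zero_of_isAlgClosed ℝ ℂ]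
      intro z
      by_cases hz : aeval z (g x) = 0
      · refine Or.inr (hy.2 x hx z ?_)
        have : g x ≠ 0 := fun h => (hS x hx).2 (by rw [h, coeff_zero])
        simpa [this] using hz
      · exact Or.inl hz)
  refine ⟨fun k => f k, fun k => (hf k).1, fun k => ?_, fun k l hkl => ?_⟩
  · refine le_antisymm (natDegree_sum_le_of_forall_le _ _ fun j _ => ?_)
      (le_natDegree_of_ne_zero (hf k).2)
    exact (natDegree_C_mul_le _ _).trans (hs j)
  · exact hf' (fun h => hkl (Fin.val_injective h))

end PolyNet

namespace PolyNet

open MvPolynomial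

/-! ### Networks over a commutative ring -/

/-- The `i`-th column of a network with weights and input in an arbitrary commutative ring. -/
noncomputable def evalNet {S : Type*} [CommRing S] {n : ℕ} {d : Fin (n + 2) → ℕ} (r : Fin n → ℕ)
    (w : (i : Fin (n + 1)) → Fin (d i.succ) → Fin (d i.castSucc) → S) (x : Fin (d 0) → S)
    (i : Fin (n + 1)) : Fin (d i.succ) → S :=
  Fin.induction (motive := fun i => Fin (d i.succ) → S)
    (fun k => ∑ j, w 0 k j * x j)
    (fun i v k => ∑ j, w i.succ k j * v j ^ r i) i

section

variable {S T : Type*} [CommRing S] [CommRing T] {n : ℕ} {d : Fin (n + 2) → ℕ} (r : Fin n → ℕ)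
  (w : (i : Fin (n + 1)) → Fin (d i.succ) → Fin (d i.castSucc) → S) (x : Fin (d 0) → S)

theorem evalNet_zero (k : Fin (d (Fin.succ 0))) : evalNet r w x 0 k = ∑ j, w 0 k j * x j := rfl

theorem evalNet_succ (i : Fin n) (k : Fin (d i.succ.succ)) :
    evalNet r w x i.succ k =
      ∑ j : Fin (d i.succ.castSucc), w i.succ k j * evalNet r w x i.castSucc j ^ r i := rfl

theorem map_evalNet (f : S →+* T) (i : Fin (n + 1)) (k : Fin (d i.succ)) :
    f (evalNet r w x i k) = evalNet r (fun i k j => f (w i k j)) (fun j => f (x j)) i k := by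
  induction i using Fin.induction with
  | zero => simp [evalNet_zero]
  | succ i ih =>
    simp only [evalNet_succ, map_sum, map_mul, map_pow]
    exact Finset.sum_congr rfl fun j _ => by rw [ih j]

end

section

variable {n : ℕ} {d : Fin (n + 2) → ℕ} (r : Fin n → ℕ) (W : Weights d)

theorem layer_zero (k : Fin (d (Fin.succ 0))) :
    layer r W 0 k = ∑ j : Fin (d 0), W 0 k j • (X j : MvPolynomial (Fin (d 0)) ℝ) := rfl

theorem layer_succ (i : Fin n) (k : Fin (d i.succ.succ)) :
    layer r W i.succ k =
      ∑ j : Fin (d i.succ.castSucc), W i.succ k j • layer r W i.castSucc j ^ r i := rfl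

theorem layer_eq_evalNet (i : Fin (n + 1)) (k : Fin (d i.succ)) :
    layer r W i k = evalNet r (fun i k j => C (W i k j)) X i k := by
  induction i using Fin.induction with
  | zero =>
    rw [evalNet_zero, layer_zero]
    exact Finset.sum_congr rfl fun j _ => smul_eq_C_mul _ _
  | succ i ih =>
    rw [evalNet_succ, layer_succ]
    exact Finset.sum_congr rfl fun j _ => by rw [smul_eq_C_mul, ih j]

end

/-- The coefficients of the output of a network whose weights are polynomials in parameters. -/
noncomputable def coeffPoly {τ : Type*} {n : ℕ} {d : Fin (n + 2) → ℕ} (r : Fin n → ℕ)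
    (w : (i : Fin (n + 1)) → Fin (d i.succ) → Fin (d i.castSucc) → MvPolynomial τ ℝ)
    (e : CoeffIndex (d (Fin.last (n + 1))) (∏ i, r i) (d 0)) : MvPolynomial τ ℝ :=
  coeff e.2.1 (evalNet (S := MvPolynomial (Fin (d 0)) (MvPolynomial τ ℝ)) r
    (fun i k j => C (w i k j)) X (Fin.last n) e.1)

theorem coords_networkMap_eval {τ : Type*} {n : ℕ} {d : Fin (n + 2) → ℕ} (r : Fin n → ℕ)
    (w : (i : Fin (n + 1)) → Fin (d i.succ) → Fin (d i.castSucc) → MvPolynomial τ ℝ)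
    (θ : τ → ℝ) (e : CoeffIndex (d (Fin.last (n + 1))) (∏ i, r i) (d 0)) :
    coords (networkMap d r fun i => Matrix.of fun k j => eval θ (w i k j)) e
      = eval θ (coeffPoly r w e) := by
  have h := map_evalNet (S := MvPolynomial (Fin (d 0)) (MvPolynomial τ ℝ)) r
    (fun i k j => C (w i k j)) X (MvPolynomial.map (eval θ)) (Fin.last n) e.1
  simp only [map_C, map_X] at h
  rw [coeffPoly, ← coeff_map, h]
  exact congrArg (coeff e.2.1) (layer_eq_evalNet r
    (fun i => Matrix.of fun k j => eval θ (w i k j)) (Fin.last n) e.1)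

theorem eval_coords_networkMap {τ : Type*} {n : ℕ} {d : Fin (n + 2) → ℕ} (r : Fin n → ℕ)
    (w : (i : Fin (n + 1)) → Fin (d i.succ) → Fin (d i.castSucc) → MvPolynomial τ ℝ)
    (θ : τ → ℝ) (F : MvPolynomial (CoeffIndex (d (Fin.last (n + 1))) (∏ i, r i) (d 0)) ℝ) :
    eval (coords (networkMap d r fun i => Matrix.of fun k j => eval θ (w i k j))) F
      = eval θ (aeval (coeffPoly r w) F) := by
  rw [funext (coords_networkMap_eval r w θ), ← aeval_eq_eval, ← aeval_eq_eval]
  change aeval _ F = ((aeval θ).comp (aeval (coeffPoly r w))) F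
  rw [comp_aeval]

theorem mem_idealOf_functionalSpace {n : ℕ} {d : Fin (n + 2) → ℕ} {r : Fin n → ℕ}
    {F : MvPolynomial (CoeffIndex (d (Fin.last (n + 1))) (∏ i, r i) (d 0)) ℝ} :
    F ∈ idealOf (functionalSpace d r) ↔ ∀ W, eval (coords (networkMap d r W)) F = 0 := by
  simp [idealOf, functionalSpace, mem_vanishingIdeal_iff]

/-! ### Normalized weights -/

/-- The positions of the weights that remain free when the first column of every weight matrix
but the last one is normalized to consist of ones. -/
abbrev FreeIndex {n : ℕ} (d : Fin (n + 2) → ℕ) : Type :=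
  {p : Σ i : Fin (n + 1), Fin (d i.succ) × Fin (d i.castSucc) //
    p.1 = Fin.last n ∨ (p.2.2 : ℕ) ≠ 0}

/-- The generic normalized weights. -/
noncomputable def normalizedWeights {n : ℕ} (d : Fin (n + 2) → ℕ) (i : Fin (n + 1))
    (k : Fin (d i.succ)) (j : Fin (d i.castSucc)) : MvPolynomial (FreeIndex d) ℝ :=
  if h : i = Fin.last n ∨ (j : ℕ) ≠ 0 then X ⟨⟨i, k, j⟩, h⟩ else 1

theorem exists_eval_normalizedWeights {n : ℕ} {d : Fin (n + 2) → ℕ} (W : Weights d)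
    (hW : ∀ i k (j : Fin (d i.castSucc)), i ≠ Fin.last n → (j : ℕ) = 0 → W i k j = 1) :
    ∃ θ : FreeIndex d → ℝ, ∀ i k j, eval θ (normalizedWeights d i k j) = W i k j := by
  refine ⟨fun p => W p.1.1 p.1.2.1 p.1.2.2, fun i k j => ?_⟩
  rw [normalizedWeights]
  split_ifs with h
  · simp
  · push Not at h
    rw [map_one, hW i k j h.1 h.2]

theorem card_freeIndex {n : ℕ} (d : Fin (n + 2) → ℕ) (hd : ∀ i, 0 < d i) :
    Fintype.card (FreeIndex d) = expectedDim d := by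
  classical
  rw [Fintype.card_subtype, Finset.card_filter, Fintype.sum_sigma, expectedDim]
  simp only [Fintype.sum_prod_type]
  rw [Fin.sum_univ_castSucc, Fin.sum_univ_castSucc, add_comm, add_left_comm]
  have hcol : ∀ m : ℕ, ∑ j : Fin m, (if (j : ℕ) ≠ 0 then 1 else 0) = m - 1 := by
    intro m
    cases m with
    | zero => simp
    | succ m => simp [Fin.sum_univ_succ]
  -- The last matrix is not normalized and contributes all its entries; positivity of its number of
  -- columns makes the truncated subtraction harmless.
  have hlast : d (Fin.last (n + 1)) + (d (Fin.last n).castSucc - 1) * d (Fin.last n).succ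
      = d (Fin.last n).succ * d (Fin.last n).castSucc := by
    obtain ⟨m, hm⟩ := Nat.exists_eq_add_of_lt (hd (Fin.last n).castSucc)
    rw [hm, ← Fin.succ_last]
    simp
    ring
  rw [hlast, add_comm]
  congr 1
  · refine Finset.sum_congr rfl fun i _ => ?_
    simp only [(Fin.castSucc_lt_last i).ne, false_or, hcol]
    simp [mul_comm]
  · simp

/-- By rescaling the entries of the hidden columns, every network with nonzero leading weights is
equal to a normalized one. -/
theorem exists_normalized_networkMap_eq {n : ℕ} {d : Fin (n + 2) → ℕ} (hd : ∀ i, 0 < d i) (r : Fin n → ℕ)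
    (W : Weights d) (hW : ∀ i k (j : Fin (d i.castSucc)), i ≠ Fin.last n → (j : ℕ) = 0 → W i k j ≠ 0) :
    ∃ W' : Weights d, (∀ i k (j : Fin (d i.castSucc)), i ≠ Fin.last n → (j : ℕ) = 0 → W' i k j = 1) ∧
      networkMap d r W = networkMap d r W' := by
  classical
  -- the accumulated scaling factors of the columns
  let c : (i : Fin (n + 1)) → Fin (d i.succ) → ℝ := fun i =>
    Fin.induction (motive := fun i => Fin (d i.succ) → ℝ)
      (fun k => if (0 : Fin (n + 1)) = Fin.last n then 1 else W 0 k ⟨0, hd _⟩)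
      (fun i v k => if i.succ = Fin.last n then 1 else
        W i.succ k ⟨0, hd _⟩ * v ⟨0, hd _⟩ ^ r i) i
  have hc : ∀ i k, c i k ≠ 0 := by
    intro i
    induction i using Fin.induction with
    | zero =>
      intro k
      change (if (0 : Fin (n + 1)) = Fin.last n then (1 : ℝ) else W 0 k ⟨0, hd _⟩) ≠ 0
      split_ifs with h
      · exact one_ne_zero
      · exact hW 0 k _ h rfl
    | succ i ih =>
      intro k
      change (if i.succ = Fin.last n then (1 : ℝ) else
        W i.succ k ⟨0, hd _⟩ * c i.castSucc ⟨0, hd _⟩ ^ r i) ≠ 0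
      split_ifs with h
      · exact one_ne_zero
      · exact mul_ne_zero (hW _ k _ h rfl) (pow_ne_zero _ (ih _))
  have hc_last : ∀ k, c (Fin.last n) k = 1 := by
    cases n with
    | zero => intro k; exact if_pos (c := (0 : Fin 1) = Fin.last 0) (e := W 0 k ⟨0, hd _⟩) rfl
    | succ n => intro k; exact if_pos (Fin.succ_last n)
  -- Dividing row `k` by `c` is undone in the next layer, where column `j` absorbs the `r i`-th
  -- power of the factor. No layer follows the last one, hence `c = 1` there.
  let W' : Weights d := Fin.cases (motive := fun i => Matrix (Fin (d i.succ)) (Fin (d i.castSucc)) ℝ)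
    (fun k j => (c 0 k)⁻¹ * W 0 k j)
    (fun i k j => (c i.succ k)⁻¹ * (W i.succ k j * c i.castSucc j ^ r i))
  have hlayer : ∀ i k, layer r W i k = c i k • layer r W' i k := by
    intro i
    induction i using Fin.induction with
    | zero =>
      intro k
      rw [layer_zero, layer_zero]
      change _ = c 0 k • ∑ j : Fin (d 0), ((c 0 k)⁻¹ * W 0 k j) • X j
      simp_rw [Finset.smul_sum, smul_smul, mul_inv_cancel_left₀ (hc 0 k)]
    | succ i ih =>
      intro k
      rw [layer_succ, layer_succ]
      change _ = c i.succ k • ∑ j : Fin (d i.succ.castSucc),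
        ((c i.succ k)⁻¹ * (W i.succ k j * c i.castSucc j ^ r i)) • layer r W' i.castSucc j ^ r i
      simp_rw [Finset.smul_sum, smul_smul, mul_inv_cancel_left₀ (hc i.succ k), ih, smul_pow,
        smul_smul]
  refine ⟨W', ?_, ?_⟩
  · intro i
    induction i using Fin.cases with
    | zero =>
      intro k j hi hj
      have hj' : j = ⟨0, hd _⟩ := Fin.ext hj
      have : c 0 k = W 0 k j := by rw [hj']; exact if_neg hi
      change (c 0 k)⁻¹ * W 0 k j = 1
      rw [← this, inv_mul_cancel₀ (hc 0 k)]
    | succ i =>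
      intro k j hi hj
      have hj' : j = ⟨0, hd _⟩ := Fin.ext hj
      have : c i.succ k = W i.succ k j * c i.castSucc j ^ r i := by rw [hj']; exact if_neg hi
      change (c i.succ k)⁻¹ * (W i.succ k j * c i.castSucc j ^ r i) = 1
      rw [← this, inv_mul_cancel₀ (hc i.succ k)]
  · ext1 k
    apply Subtype.ext
    change layer r W (Fin.last n) k = layer r W' (Fin.last n) k
    rw [hlayer, hc_last, one_smul]

/-- Restricting to normalized weights loses no equation, because weights without zero entries are
Zariski dense and can be normalized. -/
theorem idealOf_functionalSpace {n : ℕ} (d : Fin (n + 2) → ℕ) (hd : ∀ i, 0 < d i)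
    (r : Fin n → ℕ) : idealOf (functionalSpace d r) =
      RingHom.ker (aeval (coeffPoly r (normalizedWeights d)) :
        MvPolynomial (CoeffIndex (d (Fin.last (n + 1))) (∏ i, r i) (d 0)) ℝ →ₐ[ℝ] _) := by
  classical
  ext F
  rw [mem_idealOf_functionalSpace, RingHom.mem_ker]
  constructor
  · intro h
    refine MvPolynomial.funext fun θ => ?_
    rw [map_zero]
    exact (eval_coords_networkMap r _ θ F).symm.trans (h _)
  · intro h
    have hnorm : ∀ W : Weights d, (∀ i k (j : Fin (d i.castSucc)), i ≠ Fin.last n → (j : ℕ) = 0 → W i k j ≠ 0) →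
        eval (coords (networkMap d r W)) F = 0 := by
      intro W hW
      obtain ⟨W', hW', hWW'⟩ := exists_normalized_networkMap_eq hd r W hW
      obtain ⟨θ, hθ⟩ := exists_eval_normalizedWeights W' hW'
      have : W' = fun i => Matrix.of fun k j => eval θ (normalizedWeights d i k j) := by
        ext i k j
        exact (hθ i k j).symm
      rw [hWW', this]
      exact (eval_coords_networkMap r _ θ F).trans (by
        erw [h]
        exact map_zero _)
    let τ := Σ i : Fin (n + 1), Fin (d i.succ) × Fin (d i.castSucc)
    let w : (i : Fin (n + 1)) → Fin (d i.succ) → Fin (d i.castSucc) → MvPolynomial τ ℝ :=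
      fun i k j => X ⟨i, k, j⟩
    let G : MvPolynomial τ ℝ := aeval (coeffPoly r w) F
    -- `G` vanishes wherever all weights are nonzero; the product of the variables covers the
    -- remaining points.
    have hG : (∏ p : τ, X p) * G = 0 := by
      refine MvPolynomial.funext fun θ => ?_
      rw [map_mul, map_zero, map_prod]
      by_cases hθ : ∏ p : τ, eval θ (X p) = 0
      · rw [hθ, zero_mul]
      · rw [← ne_eq, Finset.prod_ne_zero_iff] at hθ
        rw [← eval_coords_networkMap r w θ F, hnorm, mul_zero]
        intro i k j _ _
        exact hθ ⟨i, k, j⟩ (Finset.mem_univ _)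
    have hG0 : G = 0 :=
      (mul_eq_zero.mp hG).resolve_left (Finset.prod_ne_zero_iff.mpr fun p _ => X_ne_zero p)
    intro W
    have := eval_coords_networkMap r w (fun p => W p.1 p.2.1 p.2.2) F
    rw [show aeval (coeffPoly r w) F = 0 from hG0, map_zero] at this
    simp only [w, eval_X] at this
    exact this

/-! ### Dimensions -/

theorem idealOf_zariskiClosure {k D m : ℕ} (S : Set (Fin k → HomPoly D m)) :
    idealOf (zariskiClosure S) = idealOf S := by
  apply le_antisymm
  · refine vanishingIdeal_anti_mono (Set.image_mono fun p hp F hF => ?_)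
    have := hF (coords p) (Set.mem_image_of_mem _ hp)
    rwa [aeval_eq_eval] at this
  · rintro F hF _ ⟨p, hp, rfl⟩
    rw [aeval_eq_eval]
    exact hp F hF

theorem dimension_functionalVariety {n : ℕ} (d : Fin (n + 2) → ℕ) (r : ℕ) :
    dimension (functionalVariety d r) = dimension (functionalSpace d fun _ => r) := by
  rw [dimension, functionalVariety, idealOf_zariskiClosure, dimension]

instance finite_degree_eq (m D : ℕ) : Finite {e : Fin m →₀ ℕ // e.degree = D} := by
  refine Finite.of_injective
    (β := (Finset.univ : Finset (Fin m)).finsuppAntidiag D) (fun e => ⟨e.1, ?_⟩) ?_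
  · rw [Finset.mem_finsuppAntidiag]
    exact ⟨by rw [← Finsupp.degree_eq_sum, e.2], Finset.subset_univ _⟩
  · intro e e' h
    exact Subtype.ext (Subtype.mk.inj h)

theorem card_coeffIndex (k D m : ℕ) :
    Nat.card (CoeffIndex k D m) = k * (m + D - 1).choose D := by
  have e : {e : Fin m →₀ ℕ // e.degree = D} ≃ (Finset.univ : Finset (Fin m)).finsuppAntidiag D :=
    Equiv.subtypeEquivRight fun e => by
      rw [Finset.mem_finsuppAntidiag, Finsupp.degree_eq_sum]
      simp
  rw [Nat.card_prod, Nat.card_congr e, Nat.card_eq_fintype_card, Nat.card_eq_fintype_card,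
    Fintype.card_fin, Fintype.card_coe, Finset.card_finsuppAntidiag_nat_eq_choose,
    Finset.card_univ, Fintype.card_fin]

theorem card_coeffIndex_const {n : ℕ} (d : Fin (n + 2) → ℕ) (r : ℕ) :
    Nat.card (CoeffIndex (d (Fin.last (n + 1))) (∏ _i : Fin n, r) (d 0)) = ambientDim d r := by
  rw [card_coeffIndex, ambientDim, Finset.prod_const, Finset.card_univ, Fintype.card_fin]

theorem dimension_le_card {k D m : ℕ} (S : Set (Fin k → HomPoly D m)) :
    dimension S ≤ (Nat.card (CoeffIndex k D m) : WithBot ℕ∞) := by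
  refine (ringKrullDim_quotient_le _).trans (le_of_eq ?_)
  rw [MvPolynomial.ringKrullDim_of_isNoetherianRing, ringKrullDim_eq_zero_of_field, zero_add]

theorem dimension_univ (k D m : ℕ) :
    dimension (Set.univ : Set (Fin k → HomPoly D m)) = Nat.card (CoeffIndex k D m) := by
  have hbot : idealOf (Set.univ : Set (Fin k → HomPoly D m)) = ⊥ := by
    rw [eq_bot_iff]
    intro F hF
    refine MvPolynomial.funext fun y => ?_
    classical
    have := Fintype.ofFinite {e : Fin m →₀ ℕ // e.degree = D}
    let p : Fin k → HomPoly D m := fun i => ∑ e : {e : Fin m →₀ ℕ // e.degree = D},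
      ⟨monomial e.1 (y (i, e)), isHomogeneous_monomial _ e.2⟩
    have hp : coords p = y := by
      ext ⟨i, e⟩
      simp [coords, p, coeff_sum, coeff_monomial, Subtype.val_inj]
    have h := hF (coords p) (Set.mem_image_of_mem _ (Set.mem_univ p))
    rw [hp, aeval_eq_eval] at h
    rw [h, map_zero]
  rw [dimension, hbot, ringKrullDim_eq_of_ringEquiv (RingEquiv.quotientBot _),
    MvPolynomial.ringKrullDim_of_isNoetherianRing, ringKrullDim_eq_zero_of_field, zero_add]

theorem dimension_functionalSpace_le {n : ℕ} (d : Fin (n + 2) → ℕ) (hd : ∀ i, 0 < d i)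
    (r : Fin n → ℕ) : dimension (functionalSpace d r) ≤ (expectedDim d : WithBot ℕ∞) := by
  rw [dimension, idealOf_functionalSpace d hd r, ← card_freeIndex d hd]
  exact ringKrullDim_quotient_ker_le _

end PolyNet

namespace PolyNet

open Polynomial

theorem coeff_sum_C_mul_X_pow {m : ℕ} (a : Fin m → ℝ) (j : Fin m) :
    (∑ l : Fin m, C (a l) * X ^ (l : ℕ)).coeff j = a j := by
  rw [finsetSum_coeff, Finset.sum_eq_single j]
  · simp
  · intro l _ hl
    rw [coeff_C_mul_X_pow, if_neg fun h => hl (Fin.ext h.symm)]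
  · simp

/-! ### Weights with pairwise coprime hidden columns -/

/-- The nodes are chosen layer by layer. The combined polynomials need to have no common root: in
the first layer `X ^ 0 = 1` ensures this, later the coprimality of two entries of the previous
column, whose width exceeds one. -/
theorem exists_weights_pairwise_isCoprime {n : ℕ} {d : Fin (n + 2) → ℕ} (h0 : 1 < d 0)
    (hd : ∀ i : Fin n, 1 < d i.succ.castSucc) {r : ℕ} (hr : 0 < r) :
    ∃ W : Weights d, (∀ i k j, W i k j ≠ 0) ∧
      (∀ i k (j : Fin (d i.castSucc)), (j : ℕ) = 0 → W i k j = 1) ∧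
      ∀ i, (∀ k, (evalNet (fun _ => r) (fun i k j => C (W i k j)) (fun l => X ^ (l : ℕ)) i
          k).natDegree = (d 0 - 1) * r ^ (i : ℕ)) ∧
        Pairwise fun k l =>
          IsCoprime (evalNet (fun _ => r) (fun i k j => C (W i k j)) (fun l => X ^ (l : ℕ)) i k)
            (evalNet (fun _ => r) (fun i k j => C (W i k j)) (fun l => X ^ (l : ℕ)) i l) := by
  -- `choose!` makes the nodes total functions of the data, so the columns can be defined
  -- recursively before the conditions on them are verified.
  choose! f hf using @exists_pairwise_isCoprime_combination
  let s : ℕ → ℕ := fun i => (d 0 - 1) * r ^ i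
  have hs : ∀ i, 0 < s i := fun i => Nat.mul_pos (by omega) (pow_pos hr _)
  let A : (i : Fin (n + 1)) → Fin (d i.succ) → ℝ[X] := fun i =>
    Fin.induction (motive := fun i => Fin (d i.succ) → ℝ[X])
      (fun k => ∑ j : Fin (d 0),
        C (f (fun l : Fin (d 0) => X ^ (l : ℕ)) (s 0) _ k ^ (j : ℕ)) * X ^ (j : ℕ))
      (fun i v k => ∑ j : Fin (d i.succ.castSucc),
        C (f (fun j => v j ^ r) (s (i + 1)) _ k ^ (j : ℕ)) * v j ^ r) i
  let w : (i : Fin (n + 1)) → Fin (d i.succ) → ℝ :=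
    Fin.cases (motive := fun i => Fin (d i.succ) → ℝ)
      (f (fun l : Fin (d 0) => X ^ (l : ℕ)) (s 0) _)
      (fun i => f (fun j => A i.castSucc j ^ r) (s (i + 1)) _)
  let W : Weights d := fun i => Matrix.of fun k j => w i k ^ (j : ℕ)
  have hA : ∀ i k, evalNet (fun _ => r) (fun i k j => C (W i k j)) (fun l => X ^ (l : ℕ)) i k
      = A i k := by
    intro i
    induction i using Fin.induction with
    | zero => intro k; rfl
    | succ i ih =>
      intro k
      rw [evalNet_succ]
      exact Finset.sum_congr rfl fun j _ => by rw [ih j]; rfl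
  have key : ∀ i : Fin (n + 1), (∀ k, w i k ≠ 0) ∧ (∀ k, (A i k).natDegree = s i) ∧
      Pairwise fun k l => IsCoprime (A i k) (A i l) := by
    intro i
    induction i using Fin.induction with
    | zero =>
      refine hf (fun l : Fin (d 0) => X ^ (l : ℕ)) (s 0) (fun j => ?_) ⟨⟨d 0 - 1, by omega⟩, ?_⟩
        (fun z => ⟨⟨0, by omega⟩, by simp⟩) _
      · rw [natDegree_X_pow]
        simp only [s, pow_zero]
        omega
      · simp [s]
    | succ i ih =>
      have hne : ∀ j, A i.castSucc j ≠ 0 := fun j h => by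
        have := ih.2.1 j
        rw [h, natDegree_zero] at this
        exact (hs _).ne this
      have hdeg : ∀ j, (A i.castSucc j ^ r).natDegree = s (i + 1) := fun j => by
        rw [natDegree_pow, ih.2.1]
        simp only [s, Fin.val_castSucc, pow_succ]
        ring
      refine hf (fun j : Fin (d i.succ.castSucc) => A i.castSucc j ^ r) (s (i + 1))
        (fun j => (hdeg j).le) ⟨⟨0, Nat.zero_lt_of_lt (hd i)⟩, ?_⟩ (fun z => ?_) _
      · rw [← hdeg ⟨0, Nat.zero_lt_of_lt (hd i)⟩]
        exact leadingCoeff_ne_zero.mpr (pow_ne_zero _ (hne _))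
      · have hco : IsCoprime _ _ := ih.2.2 (i := ⟨0, Nat.zero_lt_of_lt (hd i)⟩) (j := ⟨1, hd i⟩) (by simp)
        rw [isCoprime_iff_aeval_ne_zero_of_isAlgClosed ℝ ℂ] at hco
        rcases hco z with h | h
        · exact ⟨_, by rw [map_pow]; exact pow_ne_zero _ h⟩
        · exact ⟨_, by rw [map_pow]; exact pow_ne_zero _ h⟩
  refine ⟨W, fun i k j => pow_ne_zero _ ((key i).1 k), fun i k j hj => ?_, fun i => ?_⟩
  · change w i k ^ (j : ℕ) = 1
    rw [hj, pow_zero]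
  · simp only [hA]
    exact (key i).2

/-! ### The kernel of the differential -/

section Tangent

variable {n : ℕ} {d : Fin (n + 2) → ℕ} {M : ℕ} {W V : Weights d} {s : ℕ}
  {A B : (i : Fin (n + 1)) → Fin (d i.succ) → ℝ[X]}

theorem natDegree_tangent_le
    (hdeg : ∀ i k, (A i k).natDegree = s * (M + 1) ^ (i : ℕ)) (hs : d 0 ≤ s + 1)
    (hB0 : ∀ k, B 0 k = ∑ j : Fin (d 0), C (V 0 k j) * X ^ (j : ℕ))
    (hB : ∀ (i : Fin n) k, B i.succ k = ∑ j : Fin (d i.succ.castSucc),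
      (C (V i.succ k j) * A i.castSucc j ^ (M + 1) +
        C (W i.succ k j * (M + 1)) * (A i.castSucc j ^ M * B i.castSucc j)))
    (i : Fin (n + 1)) (k : Fin (d i.succ)) : (B i k).natDegree ≤ s * (M + 1) ^ (i : ℕ) := by
  induction i using Fin.induction with
  | zero =>
    rw [hB0]
    refine natDegree_sum_le_of_forall_le _ _ fun j _ => (natDegree_C_mul_le _ _).trans ?_
    rw [natDegree_X_pow]
    have := j.2
    simp
    omega
  | succ i ih =>
    rw [hB]
    refine natDegree_sum_le_of_forall_le _ _ fun j _ =>
      natDegree_add_le_of_degree_le ((natDegree_C_mul_le _ _).trans ?_)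
        ((natDegree_C_mul_le _ _).trans ?_)
    · rw [natDegree_pow, hdeg]
      exact le_of_eq (by simp only [Fin.val_castSucc, Fin.val_succ]; ring)
    · refine (natDegree_mul_le_of_le (natDegree_pow_le_of_le M (hdeg _ _).le) (ih j)).trans
        (le_of_eq ?_)
      simp only [Fin.val_castSucc, Fin.val_succ]
      ring

/-- Here `A` is the network at the weights `W` and `B` its derivative in the direction `V`. The
hypothesis is that `B` is entrywise proportional to `A` in layer `i`, rather than zero, because this
is the property that passes to the previous layer. -/
theorem tangent_eq_zero (hd : ∀ i, 0 < d i) (hs0 : 0 < s)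
    (hdeg : ∀ i k, (A i k).natDegree = s * (M + 1) ^ (i : ℕ)) (hs : d 0 ≤ s + 1)
    (hB0 : ∀ k, B 0 k = ∑ j : Fin (d 0), C (V 0 k j) * X ^ (j : ℕ))
    (hB : ∀ (i : Fin n) k, B i.succ k = ∑ j : Fin (d i.succ.castSucc),
      (C (V i.succ k j) * A i.castSucc j ^ (M + 1) +
        C (W i.succ k j * (M + 1)) * (A i.castSucc j ^ M * B i.castSucc j)))
    (hA0 : ∀ k, A 0 k = ∑ j : Fin (d 0), C (W 0 k j) * X ^ (j : ℕ))
    (hA : ∀ (i : Fin n) k, A i.succ k = ∑ j : Fin (d i.succ.castSucc),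
      C (W i.succ k j) * A i.castSucc j ^ (M + 1))
    (hW : ∀ i k j, W i k j ≠ 0)
    (hV : ∀ i k (j : Fin (d i.castSucc)), i ≠ Fin.last n → (j : ℕ) = 0 → V i k j = 0)
    (hstar : ∀ (i : Fin n) (q : Fin (d i.castSucc.succ) → ℝ[X]),
      (∀ j, (q j).natDegree ≤ s * (M + 1) ^ (i : ℕ)) →
      ∑ j, A i.castSucc j ^ M * q j = 0 → ∀ j, q j = 0)
    (i : Fin (n + 1)) (c : Fin (d i.succ) → ℝ) (hc : ∀ k, B i k = C (c k) * A i k)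
    (hlast : i = Fin.last n → ∀ k, c k = 0) :
    (∀ k, c k = 0) ∧ ∀ i' ≤ i, ∀ k j, V i' k j = 0 := by
  -- proportionality of the two weight matrices forces the tangent weights to vanish
  have hprop : ∀ (i : Fin (n + 1)) (c : Fin (d i.succ) → ℝ), (i = Fin.last n → ∀ k, c k = 0) →
      (∀ k j, V i k j = c k * W i k j) → (∀ k, c k = 0) ∧ ∀ k j, V i k j = 0 := by
    intro i c hlast h
    have hc0 : ∀ k, c k = 0 := by
      by_cases hi : i = Fin.last n
      · exact hlast hi
      · intro k
        have := h k ⟨0, hd _⟩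
        rw [hV i k _ hi rfl] at this
        exact (mul_eq_zero.mp this.symm).resolve_right (hW _ _ _)
    exact ⟨hc0, fun k j => by rw [h, hc0, zero_mul]⟩
  induction i using Fin.induction with
  | zero =>
    obtain ⟨h₁, h₂⟩ := hprop 0 c hlast fun k j => by
      have h := congrArg (coeff · (j : ℕ)) (hc k)
      simp only [hB0, hA0, coeff_C_mul] at h
      exact (coeff_sum_C_mul_X_pow (V 0 k) j).symm.trans
        (h.trans (congrArg (c k * ·) (coeff_sum_C_mul_X_pow (W 0 k) j)))
    refine ⟨h₁, fun i' hi' => ?_⟩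
    rw [Fin.le_zero_iff.mp hi']
    exact h₂
  | succ i ih =>
    have hA_ne : ∀ j, A i.castSucc j ≠ 0 := fun j h => by
      have := hdeg i.castSucc j
      rw [h, natDegree_zero] at this
      exact (Nat.mul_pos hs0 (pow_pos (Nat.succ_pos M) _)).ne this
    -- Collecting `B - c * A` by powers `A j ^ M` leaves cofactors of degree at most that of `A j`,
    -- so `hstar` applies.
    have hq : ∀ k j, C (V i.succ k j - c k * W i.succ k j) * A i.castSucc j +
        C (W i.succ k j * (M + 1)) * B i.castSucc j = 0 := by
      intro k
      refine hstar i _ (fun j => ?_) ?_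
      · exact natDegree_add_le_of_degree_le
          ((natDegree_C_mul_le _ _).trans (hdeg i.castSucc j).le)
          ((natDegree_C_mul_le _ _).trans (natDegree_tangent_le hdeg hs hB0 hB i.castSucc j))
      · have h := hc k
        rw [hB, hA, Finset.mul_sum, ← sub_eq_zero, ← Finset.sum_sub_distrib] at h
        rw [← h]
        refine Finset.sum_congr rfl fun j _ => ?_
        simp only [C_sub, C_mul]
        ring
    have hM : (M + 1 : ℝ) ≠ 0 := Nat.cast_add_one_ne_zero M
    have k₀ : Fin (d i.succ.succ) := ⟨0, hd _⟩
    -- A single row `k₀` of the next matrix already yields proportionality, since its weights are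
    -- nonzero.
    have hBc : ∀ j, B i.castSucc j = C ((c k₀ * W i.succ k₀ j - V i.succ k₀ j) /
        (W i.succ k₀ j * (M + 1))) * A i.castSucc j := fun j => by
      have hne := mul_ne_zero (hW i.succ k₀ j) hM
      refine mul_left_cancel₀ (C_ne_zero.mpr hne) ?_
      rw [← mul_assoc, ← C_mul, mul_div_cancel₀ _ hne]
      have := hq k₀ j
      rw [C_sub] at this ⊢
      linear_combination this
    obtain ⟨h₁, h₂⟩ := ih _ hBc fun h => absurd h (Fin.castSucc_lt_last i).ne
    have hB_zero : ∀ j, B i.castSucc j = 0 := fun j => by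
      rw [hBc j, h₁ j, C_0, zero_mul]
    obtain ⟨h₃, h₄⟩ := hprop i.succ c hlast fun k j => by
      have := hq k j
      rw [hB_zero, mul_zero, add_zero] at this
      exact sub_eq_zero.mp (C_eq_zero.mp ((mul_eq_zero.mp this).resolve_right (hA_ne j)))
    refine ⟨h₃, fun i' hi' => ?_⟩
    rcases hi'.lt_or_eq with h | rfl
    · exact h₂ i' (Fin.le_castSucc_iff.mpr h)
    · exact h₄

end Tangent

end PolyNet

namespace PolyNet

/-! ### Differentiating with dual numbers -/

/-- The tangent vector `v` at the point `θ`, as a ring homomorphism to dual numbers over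
univariate polynomials. -/
noncomputable def tangentHom {τ : Type*} (θ v : τ → ℝ) :
    MvPolynomial τ ℝ →+* DualNumber (Polynomial ℝ) :=
  MvPolynomial.eval₂Hom
    ((TrivSqZeroExt.inlHom (Polynomial ℝ) (Polynomial ℝ)).comp Polynomial.C)
    fun p => TrivSqZeroExt.inl (Polynomial.C (θ p)) + TrivSqZeroExt.inr (Polynomial.C (v p))

theorem fst_tangentHom {τ : Type*} (θ v : τ → ℝ) (f : MvPolynomial τ ℝ) :
    (tangentHom θ v f).fst = Polynomial.C (MvPolynomial.eval θ f) := by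
  induction f using MvPolynomial.induction_on with
  | C a => simp [tangentHom]
  | add p q hp hq => simp [hp, hq]
  | mul_X p i hp => simp [hp]; simp [tangentHom]

theorem snd_tangentHom {τ : Type*} [Fintype τ] (θ v : τ → ℝ) (f : MvPolynomial τ ℝ) :
    (tangentHom θ v f).snd =
      Polynomial.C (∑ p, v p * MvPolynomial.eval θ (MvPolynomial.pderiv p f)) := by
  classical
  induction f using MvPolynomial.induction_on with
  | C a => simp [tangentHom]
  | add p q hp hq => simp [hp, hq, mul_add, Finset.sum_add_distrib]
  | mul_X p i hp =>
    have hX : (tangentHom θ v (MvPolynomial.X i)).snd = Polynomial.C (v i) := by simp [tangentHom]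
    rw [map_mul, DualNumber.snd_mul, hp, hX, fst_tangentHom, fst_tangentHom, ← Polynomial.C_mul,
      ← Polynomial.C_mul, ← Polynomial.C_add]
    congr 1
    simp only [Derivation.leibniz, smul_eq_mul, MvPolynomial.pderiv_X, Pi.single_apply, map_add,
      map_mul, MvPolynomial.eval_X, mul_add, Finset.sum_add_distrib, apply_ite, map_zero,
      mul_one, mul_zero, Finset.sum_ite_eq, Finset.mem_univ, if_true, Finset.sum_mul]
    rw [mul_comm (v i)]
    refine congrArg₂ _ ?_ (Finset.sum_congr rfl fun _ _ => by ring)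
    simp

/-- The substituted values carry no infinitesimal part, so the derivative of the result is a
combination of the derivatives of the coefficients. -/
theorem snd_eval₂_tangentHom_eq_zero {τ : Type*} [Fintype τ] {m : ℕ} (θ v : τ → ℝ)
    (P : MvPolynomial (Fin m) (MvPolynomial τ ℝ)) (u : Fin m → Polynomial ℝ)
    (hP : ∀ e, ∑ p, v p * MvPolynomial.eval θ (MvPolynomial.pderiv p (P.coeff e)) = 0) :
    (MvPolynomial.eval₂Hom (tangentHom θ v) (fun l => TrivSqZeroExt.inl (u l)) P).snd = 0 := by
  rw [MvPolynomial.coe_eval₂Hom, MvPolynomial.eval₂_eq, TrivSqZeroExt.snd_sum]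
  refine Finset.sum_eq_zero fun e _ => ?_
  rw [DualNumber.snd_mul, snd_tangentHom, hP]
  have : ∏ i ∈ e.support, (TrivSqZeroExt.inl (u i) : DualNumber (Polynomial ℝ)) ^ e i
      = TrivSqZeroExt.inl (∏ i ∈ e.support, u i ^ e i) := by
    change _ = TrivSqZeroExt.inlHom (Polynomial ℝ) (Polynomial ℝ) _
    rw [map_prod]
    exact Finset.prod_congr rfl fun i _ => by rw [map_pow]; rfl
  rw [this, TrivSqZeroExt.snd_inl, mul_zero, Polynomial.C_0, zero_mul, add_zero]

/-- Only exponents of degree `∏ i, r i` are coordinates of the target space; this disposes of the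
others. -/
theorem coeff_evalNet_eq_zero {τ : Type*} {n : ℕ} {d : Fin (n + 2) → ℕ} (r : Fin n → ℕ)
    (w : (i : Fin (n + 1)) → Fin (d i.succ) → Fin (d i.castSucc) → MvPolynomial τ ℝ)
    (k : Fin (d (Fin.last n).succ)) (e : Fin (d 0) →₀ ℕ) (he : e.degree ≠ ∏ i, r i) :
    MvPolynomial.coeff e (evalNet (S := MvPolynomial (Fin (d 0)) (MvPolynomial τ ℝ)) r
      (fun i k j => MvPolynomial.C (w i k j)) MvPolynomial.X (Fin.last n) k) = 0 := by
  refine MvPolynomial.funext fun θ => ?_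
  have h := map_evalNet (S := MvPolynomial (Fin (d 0)) (MvPolynomial τ ℝ)) r
    (fun i k j => MvPolynomial.C (w i k j)) MvPolynomial.X
    (MvPolynomial.map (MvPolynomial.eval θ)) (Fin.last n) k
  simp only [MvPolynomial.map_C, MvPolynomial.map_X] at h
  rw [← MvPolynomial.coeff_map, h, map_zero]
  have hlayer := layer_eq_evalNet r
    (fun i => Matrix.of fun k j => MvPolynomial.eval θ (w i k j)) (Fin.last n) k
  simp only [Matrix.of_apply] at hlayer
  rw [← hlayer]
  refine (layer_isHomogeneous r _ (Fin.last n) k).coeff_eq_zero ?_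
  simpa [Fin.castSucc_lt_last] using he

/-! ### The lower bound -/

/-- For every sufficiently high activation degree the dimension is at least the expected one. The
linear independence that is needed holds for multiples of powers of the pairwise coprime entries of
well-chosen hidden columns, so the conjecture on powers is not required. -/
theorem expectedDim_le_dimension {n : ℕ} {d : Fin (n + 2) → ℕ} (h0 : 1 < d 0)
    (hd0 : ∀ i, 0 < d i) (hd : ∀ i : Fin n, 1 < d i.succ.castSucc) :
    ∃ r₀ : ℕ, ∀ r > r₀,
      (expectedDim d : WithBot ℕ∞) ≤ dimension (functionalSpace d fun _ => r) := by
  -- The cofactor ratio is `1` because the cofactors have at most the degree of the column entries.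
  choose N hN using fun k => exists_forall_sum_pow_mul_eq_zero ℝ k 1
  refine ⟨∑ i : Fin n, N (d i.castSucc.succ), fun r hr => ?_⟩
  obtain ⟨M, rfl⟩ : ∃ M, r = M + 1 := ⟨r - 1, by omega⟩
  obtain ⟨W, hW, hW1, hgood⟩ := exists_weights_pairwise_isCoprime h0 hd (Nat.succ_pos M)
  obtain ⟨θ, hθ⟩ := exists_eval_normalizedWeights W fun i k j _ hj => hW1 i k j hj
  rw [dimension, idealOf_functionalSpace d hd0, ← card_freeIndex d hd0]
  refine le_ringKrullDim_quotient_ker _ θ fun v hv => ?_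
  -- Normalized entries are constant, so the tangent vector is extended by zero there.
  let V : Weights d := fun i => Matrix.of fun k j =>
    if h : i = Fin.last n ∨ (j : ℕ) ≠ 0 then v ⟨⟨i, k, j⟩, h⟩ else 0
  suffices hV : ∀ i k j, V i k j = 0 by
    ext ⟨⟨i, k, j⟩, h⟩
    have := hV i k j
    simpa only [V, Matrix.of_apply, dif_pos h, Pi.zero_apply] using this
  have hweight : ∀ i k j, tangentHom θ v (normalizedWeights d i k j) =
      TrivSqZeroExt.inl (Polynomial.C (W i k j)) + TrivSqZeroExt.inr (Polynomial.C (V i k j)) := by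
    intro i k j
    rw [← hθ]
    simp only [V, Matrix.of_apply, normalizedWeights]
    split_ifs with h
    · simp [tangentHom]
    · simp
  -- Over the dual numbers one network carries both the columns (`fst`) and their derivatives along
  -- `v` (`snd`).
  set E := evalNet (S := DualNumber (Polynomial ℝ)) (d := d) (fun _ => M + 1)
    (fun i k j => tangentHom θ v (normalizedWeights d i k j))
    (fun l => TrivSqZeroExt.inl (Polynomial.X ^ (l : ℕ))) with hE
  have hfst : ∀ i k, (E i k).fst = evalNet (fun _ => M + 1)
      (fun i k j => Polynomial.C (W i k j)) (fun l => Polynomial.X ^ (l : ℕ)) i k := by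
    intro i k
    have := map_evalNet (fun _ : Fin n => M + 1)
      (fun i k j => tangentHom θ v (normalizedWeights d i k j))
      (fun l => TrivSqZeroExt.inl (Polynomial.X ^ (l : ℕ)))
      (TrivSqZeroExt.fstHom (Polynomial ℝ) (Polynomial ℝ) (Polynomial ℝ)).toRingHom i k
    refine this.trans ?_
    simp [hweight]
  have hlast : ∀ k, (E (Fin.last n) k).snd = 0 := by
    intro k
    have := map_evalNet (fun _ : Fin n => M + 1)
      (fun i k j => MvPolynomial.C (normalizedWeights d i k j))
      (MvPolynomial.X : Fin (d 0) → MvPolynomial (Fin (d 0)) (MvPolynomial (FreeIndex d) ℝ))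
      (MvPolynomial.eval₂Hom (tangentHom θ v)
        (fun l => TrivSqZeroExt.inl (Polynomial.X ^ (l : ℕ)))) (Fin.last n) k
    simp only [MvPolynomial.eval₂Hom_C, MvPolynomial.eval₂Hom_X'] at this
    rw [hE, ← this]
    refine snd_eval₂_tangentHom_eq_zero θ v _ _ fun e => ?_
    by_cases he : e.degree = ∏ _i : Fin n, (M + 1)
    · have := hv (k, ⟨e, he⟩)
      rw [MvPolynomial.aeval_X] at this
      exact this
    · rw [coeff_evalNet_eq_zero _ _ _ _ he]
      simp
  have hker := tangent_eq_zero (A := fun i k => (E i k).fst) (B := fun i k => (E i k).snd)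
    (W := W) (V := V) (M := M) (s := d 0 - 1) hd0 (by omega)
    (fun i k => by rw [hfst]; exact (hgood i).1 k) (by omega)
    (fun k => by
      rw [hE, evalNet_zero, TrivSqZeroExt.snd_sum]
      refine Finset.sum_congr rfl fun j _ => ?_
      rw [hweight]
      simp)
    (fun i k => by
      rw [hE, evalNet_succ, TrivSqZeroExt.snd_sum]
      refine Finset.sum_congr rfl fun j _ => ?_
      rw [hweight, ← hE, DualNumber.snd_mul, TrivSqZeroExt.snd_pow, TrivSqZeroExt.fst_pow]
      simp
      ring)
    (fun k => by rw [hfst, evalNet_zero]; rfl)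
    (fun i k => by
      rw [hfst, evalNet_succ]
      exact Finset.sum_congr rfl fun j _ => by rw [hfst])
    hW
    (fun i k j hi hj => by
      simp only [V, Matrix.of_apply]
      rw [dif_neg]
      push Not
      exact ⟨hi, hj⟩)
    (fun i q hq hsum => by
      have hMN : N (d i.castSucc.succ) ≤ M := by
        have := Finset.single_le_sum (f := fun i : Fin n => N (d i.castSucc.succ))
          (fun _ _ => Nat.zero_le _) (Finset.mem_univ i)
        omega
      simp only [hfst] at hsum
      exact hN _ M hMN _ (Nat.mul_pos (by omega) (pow_pos (Nat.succ_pos M) (i : ℕ))) _ q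
        (hgood i.castSucc).1 (hgood i.castSucc).2 (fun j => by rw [one_mul]; exact hq j) hsum)
    (Fin.last n) 0 (fun k => by simp [hlast k]) (fun _ _ => rfl)
  exact fun i k j => hker.2 i (Fin.le_last i) k j

/-- With a single input variable every column of forms is the output of a network. -/
theorem functionalSpace_eq_univ_of_input_eq_one {n : ℕ} {d : Fin (n + 2) → ℕ} (hd0 : ∀ i, 0 < d i)
    (h0 : d 0 = 1) (r : Fin n → ℕ) : functionalSpace d r = Set.univ := by
  classical
  refine Set.eq_univ_of_forall fun p => ?_
  have ho : ∀ j : Fin (d 0), j = ⟨0, hd0 0⟩ := fun j => Fin.ext (by have := j.2; dsimp only; omega)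
  generalize (⟨0, hd0 0⟩ : Fin (d 0)) = o at ho
  let c : Fin (d (Fin.last n).succ) → ℝ := fun k =>
    MvPolynomial.coeff (Finsupp.single o (∏ i, r i)) (p k : MvPolynomial (Fin (d 0)) ℝ)
  have hp : ∀ k, (p k : MvPolynomial (Fin (d 0)) ℝ) =
      c k • (MvPolynomial.X o : MvPolynomial (Fin (d 0)) ℝ) ^ ∏ i, r i := by
    intro k
    have hhom : (p k : MvPolynomial (Fin (d 0)) ℝ).IsHomogeneous (∏ i, r i) := (p k).2
    ext m
    have hm : m = Finsupp.single o (m o) := by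
      ext j
      rw [ho j, Finsupp.single_eq_same]
    rw [MvPolynomial.coeff_smul, MvPolynomial.coeff_X_pow, smul_eq_mul]
    by_cases hD : m o = ∏ i, r i
    · rw [hD] at hm
      rw [if_pos hm.symm, mul_one, hm]
    · rw [if_neg fun h => hD (by rw [← h, Finsupp.single_eq_same]), mul_zero]
      refine hhom.coeff_eq_zero ?_
      rwa [hm, Finsupp.degree_single]
  -- Only the first column of each matrix is used: every hidden entry is a power of the variable,
  -- and the last matrix supplies the prescribed coefficients.
  let a : (i : Fin (n + 1)) → Fin (d i.succ) → ℝ := Function.update (fun _ _ => 1) (Fin.last n) c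
  let W : Weights d := fun i => Matrix.of fun k j => if (j : ℕ) = 0 then a i k else 0
  have hlayer : ∀ i, ∃ D, ∀ k, layer r W i k =
      a i k • (MvPolynomial.X o : MvPolynomial (Fin (d 0)) ℝ) ^ D := by
    intro i
    induction i using Fin.induction with
    | zero =>
      refine ⟨1, fun k => ?_⟩
      rw [layer_zero, Finset.sum_eq_single o (fun j _ hj => absurd (ho j) hj) (by simp), pow_one]
      congr 1
      exact if_pos (by have := o.2; omega)
    | succ i ih =>
      obtain ⟨D, hD⟩ := ih
      refine ⟨D * r i, fun k => ?_⟩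
      have ha : ∀ k, a i.castSucc k = 1 := fun k => by
        simp only [a]
        rw [Function.update_of_ne (Fin.castSucc_lt_last i).ne]
      rw [layer_succ, Finset.sum_eq_single ⟨0, hd0 _⟩ (fun j _ hj => ?_) (by simp), hD, ha,
        one_smul, ← pow_mul]
      · congr 1
      · have : W i.succ k j = 0 := if_neg fun h => hj (Fin.ext h)
        rw [this, zero_smul]
  refine ⟨W, funext fun k => Subtype.ext ?_⟩
  obtain ⟨D, hD⟩ := hlayer (Fin.last n)
  have hac : a (Fin.last n) = c := Function.update_self _ _ _
  rw [hac] at hD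
  change layer r W (Fin.last n) k = p k
  rw [hp, hD]
  -- The exponent `D` was not tracked; a nonzero form has only one degree, which identifies it.
  by_cases hk : c k = 0
  · rw [hk, zero_smul, zero_smul]
  · have h₁ := (networkMap d r W k).2
    change layer r W (Fin.last n) k ∈ _ at h₁
    rw [hD, Submodule.smul_mem_iff _ hk, MvPolynomial.mem_homogeneousSubmodule] at h₁
    rw [((MvPolynomial.isHomogeneous_X_pow o D).inj_right h₁
      (pow_ne_zero _ (MvPolynomial.X_ne_zero o)))]

end PolyNet

/-! ### The three statements assembled -/

theorem mainTheorem1 {n : ℕ} (d : Fin (n + 2) → ℕ) (hd : ∀ i, 0 < d i) :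
    (∀ r : ℕ, PolyNet.dimension (PolyNet.functionalVariety d r) ≤
      ((min (PolyNet.expectedDim d) (PolyNet.ambientDim d r) : ℕ) : WithBot ℕ∞)) ∧
    (PolyNet.PowerIndependenceConjecture →
      (∀ i : Fin n, 1 < d i.succ.castSucc) →
      ∃ r₀ : ℕ, ∀ r > r₀, PolyNet.dimension (PolyNet.functionalVariety d r) =
        ((min (PolyNet.expectedDim d) (PolyNet.ambientDim d r) : ℕ) : WithBot ℕ∞)) ∧
    (0 < n → 1 < d 0 → (∀ i : Fin n, 1 < d i.succ.castSucc) →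
      {r : Fin n → ℕ | PolyNet.dimension (PolyNet.functionalSpace d r) =
        ((PolyNet.expectedDim d : ℕ) : WithBot ℕ∞)}.Infinite) := by
  have hupper : ∀ r : ℕ, PolyNet.dimension (PolyNet.functionalVariety d r) ≤
      ((min (PolyNet.expectedDim d) (PolyNet.ambientDim d r) : ℕ) : WithBot ℕ∞) := by
    intro r
    rw [PolyNet.dimension_functionalVariety]
    have h₁ := PolyNet.dimension_functionalSpace_le d hd fun _ => r
    have h₂ := PolyNet.dimension_le_card (PolyNet.functionalSpace d fun _ => r)
    rw [PolyNet.card_coeffIndex_const] at h₂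
    rcases min_choice (PolyNet.expectedDim d) (PolyNet.ambientDim d r) with h | h <;> rw [h]
    · exact h₁
    · exact h₂
  refine ⟨hupper, fun _ hhid => ?_, fun hn h0 hhid => ?_⟩
  -- With one input variable the column entries are all multiples of one power and never
  -- independent, so this case relies on the ambient dimension instead.
  · rcases (Nat.succ_le_of_lt (hd 0)).eq_or_lt with h0 | h0
    · refine ⟨0, fun r _ => le_antisymm (hupper r) ?_⟩
      rw [PolyNet.dimension_functionalVariety,
        PolyNet.functionalSpace_eq_univ_of_input_eq_one hd h0.symm, PolyNet.dimension_univ,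
        PolyNet.card_coeffIndex_const]
      exact_mod_cast min_le_right _ _
    · obtain ⟨r₀, hr₀⟩ := PolyNet.expectedDim_le_dimension h0 hd hhid
      refine ⟨r₀, fun r hr => le_antisymm (hupper r) ?_⟩
      rw [PolyNet.dimension_functionalVariety]
      refine le_trans ?_ (hr₀ r hr)
      exact_mod_cast min_le_left _ _
  · obtain ⟨r₀, hr₀⟩ := PolyNet.expectedDim_le_dimension h0 hd hhid
    -- Constant tuples already suffice; they are distinct because there is at least one activation.
    have hinj : Function.Injective fun (m : ℕ) (_ : Fin n) => r₀ + 1 + m := fun a b h => by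
      have := congrFun h ⟨0, hn⟩
      dsimp only at this
      omega
    refine (Set.infinite_range_of_injective hinj).mono ?_
    rintro _ ⟨m, rfl⟩
    exact le_antisymm (PolyNet.dimension_functionalSpace_le d hd _) (hr₀ _ (by omega))
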